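/- Let $\mu$ be a finite Borel measure on $\mathbb{R}^n$ that is absolutely continuous with respect to Lebesgue measure and satisfies $\int |y|\,d\mu(y)<\infty$. For a $\mu$-measurable set $A\subseteq\mathbb{R}^n$ with $\mu(A)>0$ let $b_\mu(A)=\frac{1}{\mu(A)}\int_A y\,d\mu(y)$ be its barycenter. Let $x$ be a point in the interior of the convex hull of $\operatorname{supp}\mu$ with $x\neq b_\mu(\mathbb{R}^n)$. A halfspace is a set $\{y:\langle y,\theta\rangle\le c\}$ with $|\theta|=1$ and $c\in\mathbb{R}$. 1. There exists a halfspace $\mathcal{H}\subset\mathbb{R}^n$ such that $\mu(\mathcal{H})>0$, $b_\mu(\mathcal{H})=x$ and $\mu(\mathcal{H})=\sup\{\mu(A): A \text{ is } \mu\text{-measurable},\ \mu(A)>0,\ b_\mu(A)=x\}$. 2. If $\mathcal{H}$ is a halfspace with $\mu(\mathcal{H})>0$, $b_\mu(\mathcal{H})=x$ and $\partial\mathcal{H}\cap\operatorname{int}(\operatorname{supp}\mu)\neq\emptyset$, then $\mathcal{H}$ is the unique halfspace of positive $\mu$-measure whose barycenter is $x$. -/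

import Mathlib

open MeasureTheory
open scoped ENNReal

namespace Isobarycentric

/-- The barycenter `b_μ(A) = μ(A)⁻¹ ∫_A y dμ(y)`. It is meaningful when `0 < μ(A) < ∞`. -/
noncomputable def barycenter {n : ℕ} (μ : Measure (EuclideanSpace ℝ (Fin n)))
    (A : Set (EuclideanSpace ℝ (Fin n))) : EuclideanSpace ℝ (Fin n) :=
  (μ.real A)⁻¹ • ∫ y in A, y ∂μ

/-- `A` is a `μ`-measurable set whose `μ`-barycenter is defined (that is, `A` is not
`μ`-null) and is equal to `x`. -/
def HasBarycenter {n : ℕ} (μ : Measure (EuclideanSpace ℝ (Fin n)))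
    (A : Set (EuclideanSpace ℝ (Fin n))) (x : EuclideanSpace ℝ (Fin n)) : Prop :=
  NullMeasurableSet A μ ∧ μ A ≠ 0 ∧ barycenter μ A = x

/-- `H` is a closed halfspace `{y : ⟪y, θ⟫ ≤ c}` with `θ` a unit vector and `c` real. The
halfspaces `{y : ⟪y, θ⟫ ≥ c}` are of this form too, with `-θ` and `-c`. -/
def IsHalfspace {n : ℕ} (H : Set (EuclideanSpace ℝ (Fin n))) : Prop :=
  ∃ (θ : EuclideanSpace ℝ (Fin n)) (c : ℝ), ‖θ‖ = 1 ∧ H = {y | inner ℝ y θ ≤ c}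

end Isobarycentric

namespace Isobarycentric

open Filter Topology Set

variable {n : ℕ} {μ : Measure (EuclideanSpace ℝ (Fin n))}

/-! Maximality is a bathtub argument. For `H = {g ≥ 0}` with `g y = c - ⟪y, θ⟫`, no set has a larger
integral of `g` than `H`. On a set with barycenter `x` that integral is `g x` times its measure, and
`g x > 0`, so `H` has the largest measure; equality makes `A \ H` null (`measure_le_halfspace`).

Existence is by duality: minimise `v ↦ ∫ (1 - ⟪v, y - x⟫)₊ dμ`. The minimum exists because `x` is
interior to the hull of the support, and stationarity says that `{⟪v, y - x⟫ ≤ 1}` has barycenter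
`x`; here `v ≠ 0` because `x` is not the barycenter of `μ`.

Uniqueness: two such halfspaces are both maximal, hence agree up to null sets, which a boundary
point interior to the support turns into equality (`halfspace_eq_of_measure_sdiff_eq_zero`). -/

theorem measurable_halfspace (θ : EuclideanSpace ℝ (Fin n)) (c : ℝ) :
    MeasurableSet {y : EuclideanSpace ℝ (Fin n) | inner ℝ y θ ≤ c} :=
  (isClosed_le (by fun_prop) (by fun_prop)).measurableSet

theorem measure_hyperplane_eq_zero (hac : μ ≪ volume) {θ : EuclideanSpace ℝ (Fin n)}
    (hθ : θ ≠ 0) (c : ℝ) : μ {y | inner ℝ y θ = c} = 0 := by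
  apply hac
  obtain ⟨p, hp⟩ : ∃ p : EuclideanSpace ℝ (Fin n), inner ℝ p θ = c := by
    refine ⟨(c / ‖θ‖ ^ 2) • θ, ?_⟩
    rw [real_inner_smul_left, real_inner_self_eq_norm_sq]
    field_simp [norm_ne_zero_iff.2 hθ]
  have h : {y : EuclideanSpace ℝ (Fin n) | inner ℝ y θ = c} =
      (fun y => y + -p) ⁻¹' ((innerSL ℝ θ).toLinearMap.ker :
        Set (EuclideanSpace ℝ (Fin n))) := by
    ext y
    simp [inner_add_right, real_inner_comm, ← hp, add_neg_eq_zero]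
  rw [h, measure_preimage_add_right]
  refine Measure.addHaar_submodule _ _ fun htop => hθ ?_
  have : θ ∈ (innerSL ℝ θ).toLinearMap.ker := htop ▸ Submodule.mem_top
  simpa using this

theorem measure_pos_of_isOpen_of_mem_support {U : Set (EuclideanSpace ℝ (Fin n))}
    (hU : IsOpen U) {y : EuclideanSpace ℝ (Fin n)} (hy : y ∈ U) (hys : y ∈ μ.support) :
    0 < μ U :=
  (Measure.mem_support_iff_forall y).1 hys U (hU.mem_nhds hy)

/-- Otherwise the hull of the support lies in `{⟪v, x⟫ ≤ ⟪v, ·⟫}`, yet it contains `x - t • v` for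
small `t > 0`. -/
theorem exists_mem_support_inner_neg {x : EuclideanSpace ℝ (Fin n)}
    (hx : x ∈ interior (convexHull ℝ μ.support)) {v : EuclideanSpace ℝ (Fin n)} (hv : v ≠ 0) :
    ∃ y ∈ μ.support, inner ℝ v (y - x) < 0 := by
  by_contra! h
  have hsub : convexHull ℝ μ.support ⊆ {y | inner ℝ v x ≤ inner ℝ v y} := by
    refine convexHull_min (fun y hy => ?_) ?_
    · have := h y hy
      rw [inner_sub_right] at this
      exact sub_nonneg.1 this
    · exact convex_halfSpace_ge (innerSL ℝ v).toLinearMap.isLinear _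
  have hcont : Tendsto (fun t : ℝ => x - t • v) (𝓝[>] 0) (𝓝 x) := by
    have : ContinuousAt (fun t : ℝ => x - t • v) 0 := by fun_prop
    simpa [ContinuousAt] using this.tendsto.mono_left nhdsWithin_le_nhds
  obtain ⟨t, ht, ht0⟩ := ((hcont.eventually (mem_interior_iff_mem_nhds.1 hx)).and
    self_mem_nhdsWithin).exists
  have h1 : inner ℝ v x ≤ inner ℝ v (x - t • v) := hsub ht
  rw [inner_sub_right, real_inner_smul_right] at h1
  have h2 := mul_pos (mem_Ioi.1 ht0) (real_inner_self_pos.2 hv)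
  linarith

theorem measure_inner_neg_pos {x : EuclideanSpace ℝ (Fin n)}
    (hx : x ∈ interior (convexHull ℝ μ.support)) {v : EuclideanSpace ℝ (Fin n)} (hv : v ≠ 0) :
    0 < μ {y | inner ℝ v (y - x) < 0} := by
  obtain ⟨y, hy, hneg⟩ := exists_mem_support_inner_neg hx hv
  exact measure_pos_of_isOpen_of_mem_support
    (isOpen_lt (by fun_prop) continuous_const) (by exact hneg) hy

theorem integrable_id_of_integrable_norm
    (hmom : Integrable (fun y : EuclideanSpace ℝ (Fin n) => ‖y‖) μ) :
    Integrable (fun y => y) μ :=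
  (integrable_norm_iff aestronglyMeasurable_id).1 hmom

/-- Bathtub principle: passing from `A` to `{0 ≤ g}` drops only negative values of `g` and adds only
nonnegative ones. -/
theorem setIntegral_le_of_nonneg_level {g : EuclideanSpace ℝ (Fin n) → ℝ}
    (hg : Integrable g μ) (A : Set (EuclideanSpace ℝ (Fin n)))
    (hm : MeasurableSet {y | 0 ≤ g y}) :
    ∫ y in A, g y ∂μ ≤ ∫ y in {y | 0 ≤ g y}, g y ∂μ ∧
      (∫ y in {y | 0 ≤ g y}, g y ∂μ ≤ ∫ y in A, g y ∂μ → μ (A \ {y | 0 ≤ g y}) = 0) := by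
  set H := {y | 0 ≤ g y} with hH
  have h1 := integral_add_compl hm (hg.restrict (s := A))
  have h2 : ∫ y in H, g y ∂(μ.restrict A) ≤ ∫ y in H, g y ∂μ := by
    refine integral_mono_measure (Measure.restrict_mono_measure Measure.restrict_le_self H) ?_
      hg.integrableOn
    filter_upwards [ae_restrict_mem hm] with y hy using hy
  have hneg : ∀ y ∈ Hᶜ, g y < 0 := fun y hy => lt_of_not_ge hy
  have h3 : ∫ y in Hᶜ, g y ∂(μ.restrict A) ≤ 0 :=
    setIntegral_nonpos hm.compl fun y hy => (hneg y hy).le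
  refine ⟨by linarith, fun h => ?_⟩
  by_contra hne
  have h4 : 0 < ∫ y in Hᶜ, (-g y) ∂(μ.restrict A) := by
    rw [setIntegral_pos_iff_support_of_nonneg_ae (f := fun y => -g y) ?_
      hg.restrict.neg.integrableOn]
    · have : Function.support (fun y => -g y) ∩ Hᶜ = Hᶜ :=
        inter_eq_right.2 fun y hy => neg_ne_zero.2 (hneg y hy).ne
      rw [this, Measure.restrict_apply hm.compl, inter_comm, ← sdiff_eq]
      exact pos_iff_ne_zero.2 hne
    · filter_upwards [ae_restrict_mem hm.compl] with y hy
      exact neg_nonneg.2 (hneg y hy).le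
  rw [integral_neg] at h4
  linarith

theorem halfspace_eq_of_measure_sdiff_eq_zero
    {θ θ' : EuclideanSpace ℝ (Fin n)} (hθ : ‖θ‖ = 1) (hθ' : ‖θ'‖ = 1) {c c' : ℝ}
    (h₁ : μ ({y | inner ℝ y θ ≤ c} \ {y | inner ℝ y θ' ≤ c'}) = 0)
    (h₂ : μ ({y | inner ℝ y θ' ≤ c'} \ {y | inner ℝ y θ ≤ c}) = 0)
    {p : EuclideanSpace ℝ (Fin n)} (hp : inner ℝ p θ = c) (hps : p ∈ interior μ.support) :
    θ' = θ ∧ c' = c := by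
  -- Near `p` every point lies in the support, so the open set `{⟪·, α⟫ < a} ∩ {b < ⟪·, β⟫}`, being
  -- null, contains none of them.
  have key : ∀ {α β : EuclideanSpace ℝ (Fin n)} {a b : ℝ},
      μ ({y | inner ℝ y α ≤ a} \ {y | inner ℝ y β ≤ b}) = 0 → ∀ w : EuclideanSpace ℝ (Fin n),
      ∀ᶠ t : ℝ in 𝓝[>] 0, inner ℝ (p + t • w) α < a → inner ℝ (p + t • w) β ≤ b := by
    intro α β a b h w
    have hcont : Tendsto (fun t : ℝ => p + t • w) (𝓝[>] 0) (𝓝 p) := by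
      have : ContinuousAt (fun t : ℝ => p + t • w) 0 := by fun_prop
      simpa [ContinuousAt] using this.tendsto.mono_left nhdsWithin_le_nhds
    filter_upwards [hcont.eventually (mem_interior_iff_mem_nhds.1 hps)] with t ht hlt
    by_contra! hgt
    have hopen : IsOpen ({y : EuclideanSpace ℝ (Fin n) | inner ℝ y α < a} ∩
        {y | b < inner ℝ y β}) :=
      (isOpen_lt (by fun_prop) (by fun_prop)).inter (isOpen_lt (by fun_prop) (by fun_prop))
    refine (measure_pos_of_isOpen_of_mem_support hopen ⟨hlt, hgt⟩ ht).ne' ?_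
    refine measure_mono_null ?_ h
    intro y hy
    refine ⟨?_, ?_⟩
    · exact le_of_lt (show inner ℝ y α < a from hy.1)
    · exact not_le_of_gt (show b < inner ℝ y β from hy.2)
  have hself : inner ℝ θ θ = (1 : ℝ) := by simp [hθ]
  have hself' : inner ℝ θ' θ' = (1 : ℝ) := by simp [hθ']
  have hcontβ : ∀ w : EuclideanSpace ℝ (Fin n),
      Tendsto (fun t : ℝ => inner ℝ (p + t • w) θ') (𝓝[>] 0) (𝓝 (inner ℝ p θ')) := by
    intro w
    have : ContinuousAt (fun t : ℝ => (inner ℝ (p + t • w) θ' : ℝ)) 0 := by fun_prop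
    simpa [ContinuousAt] using this.tendsto.mono_left nhdsWithin_le_nhds
  -- `p` also lies on the second boundary: otherwise a small move along `-θ` or `θ` reaches one
  -- halfspace minus the other.
  have hc' : inner ℝ p θ' = c' := by
    apply le_antisymm
    · by_contra! hlt
      obtain ⟨t, ⟨ht1, ht2⟩, ht0⟩ := (((key h₁ (-θ)).and
        ((hcontβ (-θ)).eventually (lt_mem_nhds hlt))).and self_mem_nhdsWithin).exists
      refine absurd (ht1 ?_) (not_le.2 ht2)
      have : (0 : ℝ) < t := ht0
      rw [inner_add_left, real_inner_smul_left, inner_neg_left, hp, hself]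
      linarith
    · by_contra! hlt
      obtain ⟨t, ⟨ht1, ht2⟩, ht0⟩ := (((key h₂ θ).and
        ((hcontβ θ).eventually (gt_mem_nhds hlt))).and self_mem_nhdsWithin).exists
      have h := ht1 ht2
      have : (0 : ℝ) < t := ht0
      rw [inner_add_left, real_inner_smul_left, hp, hself] at h
      linarith
  have hθθ : θ' = θ := by
    by_contra hne
    have hlt : inner ℝ θ' θ < (1 : ℝ) := (inner_lt_one_iff_real_of_norm_eq_one hθ' hθ).2 hne
    -- For `θ' ≠ θ`, moving along `θ' - θ` enters the first halfspace and leaves the second.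
    obtain ⟨t, ht1, ht0⟩ := ((key h₁ (θ' - θ)).and self_mem_nhdsWithin).exists
    have ht0 : (0 : ℝ) < t := ht0
    have hm : 0 < t * (1 - inner ℝ θ' θ) := mul_pos ht0 (sub_pos.2 hlt)
    simp only [inner_add_left, real_inner_smul_left, inner_sub_left, hp, hc', hself, hself',
      real_inner_comm θ' θ] at ht1
    have := ht1 (by linarith)
    linarith
  exact ⟨hθθ, by rw [← hc', ← hp, hθθ]⟩

theorem abs_max_sub_inner_sub_le (a : ℝ) (z : EuclideanSpace ℝ (Fin n))
    (v w : EuclideanSpace ℝ (Fin n)) :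
    |max (a - inner ℝ v z) 0 - max (a - inner ℝ w z) 0| ≤ ‖v - w‖ * ‖z‖ := by
  refine (abs_max_sub_max_le_abs _ _ _).trans ?_
  have : a - inner ℝ v z - (a - inner ℝ w z) = inner ℝ (w - v) z := by
    rw [inner_sub_left]; ring
  rw [this, norm_sub_rev]
  exact abs_real_inner_le_norm _ _

/-! ### Maximality of halfspaces among sets with a given barycenter -/

variable [IsFiniteMeasure μ]

theorem setIntegral_sub_inner (hint : Integrable (fun y => y) μ)
    {A : Set (EuclideanSpace ℝ (Fin n))} {x : EuclideanSpace ℝ (Fin n)}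
    (hA : HasBarycenter μ A x) (θ : EuclideanSpace ℝ (Fin n)) (c : ℝ) :
    ∫ y in A, (c - inner ℝ y θ) ∂μ = (c - inner ℝ x θ) * μ.real A := by
  have hpos : μ.real A ≠ 0 := (measureReal_ne_zero_iff (measure_ne_top _ _)).2 hA.2.1
  have hbar : ∫ y in A, y ∂μ = μ.real A • x := by
    rw [← hA.2.2, barycenter, smul_inv_smul₀ hpos]
  rw [integral_sub (integrable_const _) (hint.integrableOn.inner_const θ)]
  simp_rw [real_inner_comm θ]
  rw [integral_inner hint.integrableOn, hbar, real_inner_smul_right]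
  simp
  ring

theorem integrable_sub_inner (hint : Integrable (fun y => y) μ)
    (θ : EuclideanSpace ℝ (Fin n)) (c : ℝ) : Integrable (fun y => c - inner ℝ y θ) μ :=
  (integrable_const _).sub (hint.inner_const θ)

/-- Strict because the bounding hyperplane is null, so `c - ⟪y, θ⟫` is positive almost everywhere on
the halfspace. -/
theorem inner_barycenter_lt (hac : μ ≪ volume) (hint : Integrable (fun y => y) μ)
    {θ x : EuclideanSpace ℝ (Fin n)} (hθ : θ ≠ 0) {c : ℝ}
    (hH : HasBarycenter μ {y | inner ℝ y θ ≤ c} x) : inner ℝ x θ < c := by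
  set H : Set (EuclideanSpace ℝ (Fin n)) := {y | inner ℝ y θ ≤ c} with hHdef
  have hpos : 0 < μ.real H := ENNReal.toReal_pos hH.2.1 (measure_ne_top _ _)
  have hI : 0 < ∫ y in H, (c - inner ℝ y θ) ∂μ := by
    rw [setIntegral_pos_iff_support_of_nonneg_ae ?_
      (integrable_sub_inner hint θ c).integrableOn]
    · refine lt_of_lt_of_le (pos_iff_ne_zero.2 hH.2.1) ?_
      calc μ H = μ (H \ {y | inner ℝ y θ = c}) :=
            (measure_sdiff_null (measure_hyperplane_eq_zero hac hθ c)).symm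
        _ ≤ _ := by
            refine measure_mono fun y hy => ⟨fun h => hy.2 ?_, hy.1⟩
            exact (sub_eq_zero.1 h).symm
    · filter_upwards [ae_restrict_mem (measurable_halfspace θ c)] with y hy
      exact sub_nonneg.2 hy
  rw [setIntegral_sub_inner hint hH] at hI
  exact sub_pos.1 (pos_of_mul_pos_left hI hpos.le)

theorem measure_le_halfspace (hac : μ ≪ volume) (hint : Integrable (fun y => y) μ)
    {θ x : EuclideanSpace ℝ (Fin n)} (hθ : θ ≠ 0) {c : ℝ}
    (hH : HasBarycenter μ {y | inner ℝ y θ ≤ c} x) {A : Set (EuclideanSpace ℝ (Fin n))}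
    (hA : HasBarycenter μ A x) :
    μ A ≤ μ {y | inner ℝ y θ ≤ c} ∧
      (μ {y | inner ℝ y θ ≤ c} ≤ μ A → μ (A \ {y | inner ℝ y θ ≤ c}) = 0) := by
  have hlt := sub_pos.2 (inner_barycenter_lt hac hint hθ hH)
  have hset : {y : EuclideanSpace ℝ (Fin n) | 0 ≤ c - inner ℝ y θ} =
      {y | inner ℝ y θ ≤ c} := by
    ext y
    exact sub_nonneg (a := c) (b := inner ℝ y θ)
  obtain ⟨h1, h2⟩ := setIntegral_le_of_nonneg_level (integrable_sub_inner hint θ c) A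
    (by rw [hset]; exact measurable_halfspace θ c)
  rw [hset, setIntegral_sub_inner hint hA, setIntegral_sub_inner hint hH] at h1 h2
  rw [mul_le_mul_iff_right₀ hlt] at h1 h2
  simp only [measureReal_def, ENNReal.toReal_le_toReal (measure_ne_top _ _)
    (measure_ne_top _ _)] at h1 h2
  exact ⟨h1, h2⟩

/-! ### Existence by minimising the dual objective -/

/-- The dual objective `v ↦ ∫ (a - ⟪v, y - x⟫)₊ dμ(y)`. -/
noncomputable def dualObjective (μ : Measure (EuclideanSpace ℝ (Fin n)))
    (x : EuclideanSpace ℝ (Fin n)) (a : ℝ) (v : EuclideanSpace ℝ (Fin n)) : ℝ :=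
  ∫ y, max (a - inner ℝ v (y - x)) 0 ∂μ

theorem integrable_max_sub_inner (hint : Integrable (fun y => y) μ)
    (x : EuclideanSpace ℝ (Fin n)) (a : ℝ) (v : EuclideanSpace ℝ (Fin n)) :
    Integrable (fun y => max (a - inner ℝ v (y - x)) 0) μ :=
  ((integrable_const a).sub ((hint.sub (integrable_const x)).const_inner v)).pos_part

theorem continuous_dualObjective (hint : Integrable (fun y => y) μ)
    (x : EuclideanSpace ℝ (Fin n)) (a : ℝ) : Continuous (dualObjective μ x a) := by
  refine continuous_iff_continuousAt.2 fun v => ?_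
  refine continuousAt_of_dominated
    (bound := fun y => |a| + (‖v‖ + 1) * ‖y - x‖)
    (Eventually.of_forall fun w => (integrable_max_sub_inner hint x a w).aestronglyMeasurable)
    ?_ ((integrable_const _).add ((hint.sub (integrable_const x)).norm.const_mul _))
    (Eventually.of_forall fun y => by fun_prop)
  have hball : ∀ᶠ w in 𝓝 v, ‖w‖ < ‖v‖ + 1 :=
    continuous_norm.continuousAt.eventually (gt_mem_nhds (by linarith))
  filter_upwards [hball] with w hw
  refine Eventually.of_forall fun y => ?_
  rw [Real.norm_of_nonneg (le_max_right _ _)]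
  have h1 := abs_real_inner_le_norm w (y - x)
  have h2 : ‖w‖ * ‖y - x‖ ≤ (‖v‖ + 1) * ‖y - x‖ := by gcongr
  have h3 := neg_le_abs (inner ℝ w (y - x))
  have h4 := le_abs_self a
  refine max_le (by linarith) (by positivity)

theorem dualObjective_zero_pos (hint : Integrable (fun y => y) μ)
    {x : EuclideanSpace ℝ (Fin n)} (hx : x ∈ interior (convexHull ℝ μ.support))
    {v : EuclideanSpace ℝ (Fin n)} (hv : v ≠ 0) : 0 < dualObjective μ x 0 v := by
  rw [dualObjective, integral_pos_iff_support_of_nonneg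
    (f := fun y => max (0 - inner ℝ v (y - x)) 0) (fun y => le_max_right _ _)
    (integrable_max_sub_inner hint x 0 v)]
  refine (measure_inner_neg_pos hx hv).trans_le (measure_mono fun y hy => ?_)
  have hy : inner ℝ v (y - x) < 0 := hy
  exact (lt_max_of_lt_left (by linarith)).ne'

/-- Coercivity: the objective with `a = 0` is positively homogeneous, bounded below by a positive
constant on the unit sphere, and at most the objective with `a = 1`. -/
theorem exists_isMin_dualObjective (hint : Integrable (fun y => y) μ)
    {x : EuclideanSpace ℝ (Fin n)} (hx : x ∈ interior (convexHull ℝ μ.support)) :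
    ∃ v, ∀ w, dualObjective μ x 1 v ≤ dualObjective μ x 1 w := by
  -- The sphere is empty only when `0` is the sole vector.
  rcases isEmpty_or_nonempty (Metric.sphere (0 : EuclideanSpace ℝ (Fin n)) 1) with he | hne
  · refine ⟨0, fun w => ?_⟩
    by_cases hw : w = 0
    · rw [hw]
    · exact (he.false ⟨‖w‖⁻¹ • w, by simp [norm_smul, norm_ne_zero_iff.2 hw]⟩).elim
  obtain ⟨u, hu, hmin⟩ := (isCompact_sphere (0 : EuclideanSpace ℝ (Fin n)) 1).exists_isMinOn
    (nonempty_coe_sort.1 hne) (continuous_dualObjective hint x 0).continuousOn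
  have hδ : 0 < dualObjective μ x 0 u :=
    dualObjective_zero_pos hint hx (by rintro rfl; simp at hu)
  refine (continuous_dualObjective hint x 1).exists_forall_le ?_
  refine tendsto_atTop_mono (f := fun v => ‖v‖ * dualObjective μ x 0 u) (fun v => ?_)
    ((tendsto_norm_cocompact_atTop (E := EuclideanSpace ℝ (Fin n))).atTop_mul_const hδ)
  by_cases hv : v = 0
  · rw [hv, norm_zero, zero_mul]
    exact integral_nonneg fun y => le_max_right _ _
  have hv' : ‖v‖ ≠ 0 := norm_ne_zero_iff.2 hv
  have h1 : dualObjective μ x 0 u ≤ dualObjective μ x 0 (‖v‖⁻¹ • v) :=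
    hmin (by simp [norm_smul, hv'])
  calc ‖v‖ * dualObjective μ x 0 u ≤ ‖v‖ * dualObjective μ x 0 (‖v‖⁻¹ • v) := by gcongr
    _ = dualObjective μ x 0 v := by
      rw [dualObjective, dualObjective, ← integral_const_mul]
      congr 1 with y
      rw [mul_max_of_nonneg _ _ (norm_nonneg v), real_inner_smul_left, mul_sub,
        mul_inv_cancel_left₀ hv']
      simp
    _ ≤ dualObjective μ x 1 v :=
      integral_mono (integrable_max_sub_inner hint x 0 v) (integrable_max_sub_inner hint x 1 v)
        fun y => max_le_max (by linarith) le_rfl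

/-- First-order condition in the direction `w`. The integrand has its kink only on the null set
`{⟪v, y - x⟫ = 1}`, and the Lipschitz bound `‖w‖ * ‖y - x‖` allows differentiation under the
integral. -/
theorem setIntegral_inner_eq_zero_of_isMin (hac : μ ≪ volume)
    (hint : Integrable (fun y => y) μ) {x v : EuclideanSpace ℝ (Fin n)}
    (hmin : ∀ w, dualObjective μ x 1 v ≤ dualObjective μ x 1 w)
    (w : EuclideanSpace ℝ (Fin n)) :
    ∫ y in {y | inner ℝ v (y - x) ≤ 1}, inner ℝ w (y - x) ∂μ = 0 := by
  set H : Set (EuclideanSpace ℝ (Fin n)) := {y | inner ℝ v (y - x) ≤ 1} with hH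
  have hm : MeasurableSet H := (isClosed_le (by fun_prop) (by fun_prop)).measurableSet
  have hz : Integrable (fun y => y - x) μ := hint.sub (integrable_const x)
  have hnull : ∀ᵐ y ∂μ, inner ℝ v (y - x) ≠ 1 := by
    by_cases hv : v = 0
    · simp [hv]
    · refine measure_mono_null (fun y hy => ?_)
        (measure_hyperplane_eq_zero hac hv (1 + inner ℝ v x))
      have hy : inner ℝ v (y - x) = 1 := not_not.1 hy
      rw [inner_sub_right] at hy
      rw [mem_ofPred_eq, real_inner_comm]
      linarith
  have hder := (hasDerivAt_integral_of_dominated_loc_of_lip (μ := μ) (x₀ := (0 : ℝ))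
    (F := fun t y => max (1 - inner ℝ (v + t • w) (y - x)) 0)
    (F' := H.indicator fun y => -inner ℝ w (y - x)) (s := univ)
    (bound := fun y => ‖w‖ * ‖y - x‖) univ_mem
    (Eventually.of_forall fun t =>
      (integrable_max_sub_inner hint x 1 (v + t • w)).aestronglyMeasurable)
    (integrable_max_sub_inner hint x 1 _)
    ((hz.const_inner w).neg.indicator hm).aestronglyMeasurable
    (Eventually.of_forall fun y => LipschitzOnWith.of_dist_le_mul fun s _ t _ => by
      rw [Real.dist_eq, Real.dist_eq]
      refine (abs_max_sub_inner_sub_le 1 (y - x) _ _).trans_eq ?_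
      rw [add_sub_add_left_eq_sub, ← sub_smul, norm_smul, Real.norm_eq_abs, Real.coe_nnabs,
        abs_of_nonneg (mul_nonneg (norm_nonneg w) (norm_nonneg (y - x)))]
      ring)
    (hz.norm.const_mul _) ?_).2
  · have hloc : IsLocalMin
        (fun t : ℝ => ∫ y, max (1 - inner ℝ (v + t • w) (y - x)) 0 ∂μ) 0 :=
      Eventually.of_forall fun t => by
        simpa [dualObjective] using hmin (v + t • w)
    have h0 := hloc.hasDerivAt_eq_zero hder
    rwa [integral_indicator hm, integral_neg, neg_eq_zero] at h0
  · filter_upwards [hnull] with y hy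
    have hlin : HasDerivAt (fun t : ℝ => 1 - inner ℝ (v + t • w) (y - x))
        (-inner ℝ w (y - x)) 0 := by
      simp only [inner_add_left, real_inner_smul_left]
      simpa using (((hasDerivAt_id (0 : ℝ)).mul_const (inner ℝ w (y - x))).const_add
        (inner ℝ v (y - x))).const_sub 1
    rcases lt_or_gt_of_ne hy with hlt | hgt
    · rw [indicator_of_mem (show y ∈ H from hlt.le)]
      refine hlin.congr_of_eventuallyEq ?_
      filter_upwards [hlin.continuousAt.eventually
        (lt_mem_nhds (show (0 : ℝ) < _ by simpa using hlt))] with t ht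
      exact max_eq_left ht.le
    · rw [indicator_of_notMem (show y ∉ H from not_le.2 hgt)]
      refine (hasDerivAt_const (0 : ℝ) (0 : ℝ)).congr_of_eventuallyEq ?_
      filter_upwards [hlin.continuousAt.eventually
        (gt_mem_nhds (show _ < (0 : ℝ) by simpa using hgt))] with t ht
      exact max_eq_right ht.le

theorem barycenter_eq_of_setIntegral_inner_eq_zero (hint : Integrable (fun y => y) μ)
    {A : Set (EuclideanSpace ℝ (Fin n))} (hA : μ A ≠ 0) {x : EuclideanSpace ℝ (Fin n)}
    (h : ∀ w, ∫ y in A, inner ℝ w (y - x) ∂μ = 0) : barycenter μ A = x := by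
  have hz : Integrable (fun y => y - x) μ := hint.sub (integrable_const x)
  have h0 : ∫ y in A, (y - x) ∂μ = 0 := by
    refine ext_inner_left ℝ fun w => ?_
    rw [← integral_inner hz.integrableOn, h w, inner_zero_right]
  rw [integral_sub hint.integrableOn (integrable_const x), setIntegral_const,
    sub_eq_zero] at h0
  rw [barycenter, h0, inv_smul_smul₀ ((measureReal_ne_zero_iff (measure_ne_top _ _)).2 hA)]

theorem exists_halfspace_hasBarycenter (hac : μ ≪ volume) (hint : Integrable (fun y => y) μ)
    {x : EuclideanSpace ℝ (Fin n)} (hx : x ∈ interior (convexHull ℝ μ.support))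
    (hxb : x ≠ barycenter μ univ) :
    ∃ (θ : EuclideanSpace ℝ (Fin n)) (c : ℝ), ‖θ‖ = 1 ∧
      HasBarycenter μ {y | inner ℝ y θ ≤ c} x := by
  obtain ⟨v, hmin⟩ := exists_isMin_dualObjective hint hx
  have hzero := setIntegral_inner_eq_zero_of_isMin hac hint hmin
  -- For `v = 0` the set `{⟪v, y - x⟫ ≤ 1}` is the whole space, so `x` would be the barycenter of
  -- `μ`.
  have hv : v ≠ 0 := by
    rintro rfl
    have hμ : μ univ ≠ 0 := by
      rw [Measure.measure_univ_ne_zero]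
      rintro rfl
      simp at hx
    refine hxb (barycenter_eq_of_setIntegral_inner_eq_zero hint hμ ?_).symm
    simpa using hzero
  have hv' : 0 < ‖v‖ := norm_pos_iff.2 hv
  have hset : {y : EuclideanSpace ℝ (Fin n) |
      inner ℝ y (‖v‖⁻¹ • v) ≤ ‖v‖⁻¹ * (1 + inner ℝ v x)} = {y | inner ℝ v (y - x) ≤ 1} := by
    ext y
    rw [mem_ofPred_eq, mem_ofPred_eq, real_inner_smul_right,
      mul_le_mul_iff_right₀ (inv_pos.2 hv'), inner_sub_right, sub_le_iff_le_add,
      real_inner_comm]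
  have hpos : μ {y | inner ℝ v (y - x) ≤ 1} ≠ 0 :=
    ((measure_inner_neg_pos hx hv).trans_le (measure_mono fun y hy =>
      le_trans (le_of_lt (show inner ℝ v (y - x) < 0 from hy)) zero_le_one)).ne'
  refine ⟨‖v‖⁻¹ • v, ‖v‖⁻¹ * (1 + inner ℝ v x), by simp [norm_smul, hv'.ne'],
    (measurable_halfspace _ _).nullMeasurableSet, ?_⟩
  rw [hset]
  exact ⟨hpos, barycenter_eq_of_setIntegral_inner_eq_zero hint hpos hzero⟩

end Isobarycentric

theorem theorem1p1 (n : ℕ) (μ : MeasureTheory.Measure (EuclideanSpace ℝ (Fin n)))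
    [MeasureTheory.IsFiniteMeasure μ]
    (hac : μ.AbsolutelyContinuous MeasureTheory.volume)
    (hmom : MeasureTheory.Integrable (fun y : EuclideanSpace ℝ (Fin n) => ‖y‖) μ)
    (x : EuclideanSpace ℝ (Fin n))
    (hx : x ∈ interior (convexHull ℝ μ.support))
    (hxb : x ≠ Isobarycentric.barycenter μ Set.univ) :
    (∃ H : Set (EuclideanSpace ℝ (Fin n)),
      Isobarycentric.IsHalfspace H ∧ Isobarycentric.HasBarycenter μ H x ∧
        μ H = sSup {m : ENNReal | ∃ A : Set (EuclideanSpace ℝ (Fin n)),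
          Isobarycentric.HasBarycenter μ A x ∧ m = μ A}) ∧
    (∀ H : Set (EuclideanSpace ℝ (Fin n)),
      Isobarycentric.IsHalfspace H → Isobarycentric.HasBarycenter μ H x →
        (frontier H ∩ interior μ.support).Nonempty →
          ∀ H' : Set (EuclideanSpace ℝ (Fin n)),
            Isobarycentric.IsHalfspace H' → Isobarycentric.HasBarycenter μ H' x → H' = H) := by
  have hint := Isobarycentric.integrable_id_of_integrable_norm hmom
  have hne : ∀ {θ : EuclideanSpace ℝ (Fin n)}, ‖θ‖ = 1 → θ ≠ 0 := fun hθ h => by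
    simp [h] at hθ
  constructor
  · obtain ⟨θ, c, hθ, hH⟩ :=
      Isobarycentric.exists_halfspace_hasBarycenter hac hint hx hxb
    refine ⟨_, ⟨θ, c, hθ, rfl⟩, hH, le_antisymm (le_sSup ⟨_, hH, rfl⟩) (sSup_le ?_)⟩
    rintro _ ⟨A, hA, rfl⟩
    exact (Isobarycentric.measure_le_halfspace hac hint (hne hθ) hH hA).1
  · rintro _ ⟨θ, c, hθ, rfl⟩ hH ⟨p, hpf, hps⟩ _ ⟨θ', c', hθ', rfl⟩ hH'
    have hp : inner ℝ p θ = c := frontier_le_subset_eq (by fun_prop) (by fun_prop) hpf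
    have h₁ := Isobarycentric.measure_le_halfspace hac hint (hne hθ) hH hH'
    have h₂ := Isobarycentric.measure_le_halfspace hac hint (hne hθ') hH' hH
    -- Each halfspace has at most the measure of the other, so both equality cases apply and both
    -- differences are null.
    obtain ⟨rfl, rfl⟩ := Isobarycentric.halfspace_eq_of_measure_sdiff_eq_zero hθ hθ'
      (h₂.2 h₁.1) (h₁.2 h₂.1) hp hps
    rfl
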